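/- Let $N\ge 1$ be an integer, let $\mathbb U=\{z\in\mathbb C:|z|=1\}$, endowed with the length distance $d_{\mathbb U}$, for which $d_{\mathbb U}(e^{i\alpha},e^{i\beta})=|\alpha-\beta|$ whenever $|\alpha-\beta|\le\pi$, and let $\mathsf U(N)$ be the group of unitary $N\times N$ complex matrices. On its Lie algebra $\mathfrak u(N)$ of anti-Hermitian matrices consider the real scalar product $\langle X,Y\rangle=N\,\mathrm{Tr}(X^*Y)$, where $\mathrm{Tr}$ is the usual trace, and endow $\mathsf U(N)$ with the Riemannian distance $d$ of the left-invariant Riemannian metric that equals $\langle\cdot,\cdot\rangle$ at the identity. For a function $f:\mathbb U\to\mathbb R$, define $\mathrm{tr} f:\mathsf U(N)\to\mathbb R$ by $(\mathrm{tr} f)(U)=\frac1N\mathrm{Tr}(f(U))$, where the matrix $f(U)$ is given by functional calculus. Set $$\|f\|_{\rm Lip}=\sup_{z\ne w}\frac{|f(z)-f(w)|}{d_{\mathbb U}(z,w)},\qquad \|F\|_{\rm Lip}=\sup_{U\ne V}\frac{|F(U)-F(V)|}{d(U,V)}$$ for $f:\mathbb U\to\mathbb R$ and $F:\mathsf U(N)\to\mathbb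 R$. Let $f:\mathbb U\to\mathbb R$ be Lipschitz continuous with respect to $d_{\mathbb U}$. Then $\mathrm{tr} f:\mathsf U(N)\to\mathbb R$ is Lipschitz continuous with respect to $d$, and $$\|\mathrm{tr} f\|_{\rm Lip}=\frac1N\,\|f\|_{\rm Lip}.$$ -/

import Mathlib

open scoped ENNReal NNReal Matrix

noncomputable section

namespace UnitaryLip

/-! ### Lipschitz functions and Lipschitz norms for a given distance -/

/-- `F` is Lipschitz continuous for the distance `d`. -/
def IsLipschitz {X : Type*} (d : X → X → ℝ≥0∞) (F : X → ℝ) : Prop :=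
  ∃ K : ℝ≥0, ∀ x y : X, ENNReal.ofReal |F x - F y| ≤ K * d x y

/-- The Lipschitz norm `sup { |F x - F y| / d x y : x ≠ y }`, a supremum in `[0, ∞]`. -/
def lipNorm {X : Type*} (d : X → X → ℝ≥0∞) (F : X → ℝ) : ℝ≥0∞ :=
  ⨆ (x : X) (y : X) (_ : x ≠ y), ENNReal.ofReal |F x - F y| / d x y

/-! ### The length distance on the circle -/

/-- The length distance on the unit circle, `d (e^{iα}, e^{iβ}) = |α - β|` for `|α - β| ≤ π`
(see `arcDist_exp`). -/
def arcDist (z w : Circle) : ℝ≥0∞ :=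
  ENNReal.ofReal |Complex.arg ((z / w : Circle) : ℂ)|

theorem arcDist_exp (a b : ℝ) (h : |a - b| ≤ Real.pi) :
    arcDist (Circle.exp a) (Circle.exp b) = ENNReal.ofReal |a - b| := by
  rw [arcDist, ← Circle.exp_sub]
  rcases eq_or_lt_of_le (abs_le.1 h).1 with h1 | h1
  · have h2 : ((Circle.exp (a - b) : Circle) : ℂ) = -1 := by
      rw [← h1, Circle.exp_neg, Circle.coe_inv, Circle.coe_exp, Complex.exp_pi_mul_I]
      norm_num
    rw [h2, Complex.arg_neg_one, ← h1, abs_neg]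
  · rw [Circle.arg_exp h1 (abs_le.1 h).2]

/-! ### The Riemannian distance on the unitary group -/

/-- The scalar product `⟨X, Y⟩ = N Tr (X* Y)` on the Lie algebra of anti-Hermitian matrices
(there, `Tr (X* Y)` is real). -/
def lieInner {N : ℕ} (X Y : Matrix (Fin N) (Fin N) ℂ) : ℝ :=
  N * (Matrix.trace (Xᴴ * Y)).re

/-- The norm associated with `lieInner`. -/
def lieNorm {N : ℕ} (X : Matrix (Fin N) (Fin N) ℂ) : ℝ :=
  √(lieInner X X)

/-- `γ`, restricted to `[0, 1]`, is a path of class `C^1` in the unitary group from `U` to `V`. -/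
structure IsC1Path {N : ℕ} (U V : Matrix.unitaryGroup (Fin N) ℂ)
    (γ : ℝ → Matrix (Fin N) (Fin N) ℂ) : Prop where
  mem : ∀ t ∈ Set.Icc (0 : ℝ) 1, γ t ∈ Matrix.unitaryGroup (Fin N) ℂ
  source : γ 0 = U
  target : γ 1 = V
  contDiffOn : ∀ i j, ContDiffOn ℝ 1 (fun t ↦ γ t i j) (Set.Icc 0 1)

/-- The velocity `γ'(t)` of a path defined on `[0, 1]`, computed entrywise. -/
def velocity {N : ℕ} (γ : ℝ → Matrix (Fin N) (Fin N) ℂ) (t : ℝ) : Matrix (Fin N) (Fin N) ℂ :=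
  Matrix.of fun i j ↦ derivWithin (fun s ↦ γ s i j) (Set.Icc 0 1) t

/-- The length of a path for the left-invariant Riemannian metric which is equal to `lieInner` at
the identity: the tangent vector `γ'(t)` at `γ(t)` is brought back to the Lie algebra by left
translation, to `γ(t)⁻¹ γ'(t) = γ(t)* γ'(t)`. -/
def pathLength {N : ℕ} (γ : ℝ → Matrix (Fin N) (Fin N) ℂ) : ℝ≥0∞ :=
  ∫⁻ t in Set.Icc (0 : ℝ) 1, ENNReal.ofReal (lieNorm ((γ t)ᴴ * velocity γ t))

/-- The Riemannian distance on the unitary group: the infimum of the lengths of the paths of class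
`C^1` joining two points. -/
def riemDist {N : ℕ} (U V : Matrix.unitaryGroup (Fin N) ℂ) : ℝ≥0∞ :=
  ⨅ (γ : ℝ → Matrix (Fin N) (Fin N) ℂ) (_ : IsC1Path U V γ), pathLength γ

/-! ### Functional calculus and normalized trace -/

open scoped Matrix.Norms.L2Operator in
/-- The matrix `f(U)` obtained from a function `f` on the circle and a unitary matrix `U` by
functional calculus. The function is extended by zero to `ℂ`; since the spectrum of `U` is a finite
subset of the circle, the extension is continuous on the spectrum and its values outside the circle
do not matter. -/
def funCalc {N : ℕ} (f : Circle → ℝ) (U : Matrix.unitaryGroup (Fin N) ℂ) :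
    Matrix (Fin N) (Fin N) ℂ :=
  cfc (Function.extend ((↑) : Circle → ℂ) (fun z ↦ (f z : ℂ)) 0) (U : Matrix (Fin N) (Fin N) ℂ)

/-- The function `tr f : U ↦ tr (f(U))`, where `tr = N⁻¹ Tr` is the normalized trace (`f(U)` is
Hermitian, so that its trace is real). -/
def trFun {N : ℕ} (f : Circle → ℝ) (U : Matrix.unitaryGroup (Fin N) ℂ) : ℝ :=
  (Matrix.trace (funCalc f U)).re / N

end UnitaryLip

end

namespace UnitaryLip

/-! ### Arcs and chords -/

/-! Upper bound: if `P z` and `Q w` are the spectral projections of `U` and `V`, the weights `S z w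
= Tr (P z * Q w)` are nonnegative and couple the two spectra, counted with multiplicity. Their total
mass is `N`, and their quadratic cost for the planar distance is the squared Hilbert-Schmidt norm of
`U - V` (`exists_coupling`). If `f` has Lipschitz constant `L`, Cauchy-Schwarz gives `|Tr f(U) - Tr
f(V)| ≤ L √N ‖U - V‖`, up to a second-order error from replacing arcs by chords
(`abs_trace_funCalc_sub_le`). Summed over fine subdivisions of a `C^1` path the error vanishes
(`abs_sub_le_integral_norm`), leaving `L` times the length `√N ∫ ‖γ'‖`; dividing by `N` gives the
constant `L / N`.

Lower bound: on scalar matrices `tr f` takes the values of `f`, while distances are at most `N`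
times those on the circle. -/

theorem norm_coe_sub_coe (z w : Circle) :
    ‖(z : ℂ) - w‖ = 2 * Real.sin (|Complex.arg ((z / w : Circle) : ℂ)| / 2) := by
  set θ := Complex.arg ((z / w : Circle) : ℂ) with hθ
  have h1 : ((z / w : Circle) : ℂ) = Complex.exp (Complex.I * θ) := by
    rw [← Circle.exp_arg (z / w), ← hθ, Circle.coe_exp, mul_comm]
  have h2 : ‖(z : ℂ) - w‖ = ‖Complex.exp (Complex.I * θ) - 1‖ := by
    rw [← h1, Circle.coe_div, ← mul_one ‖_ - 1‖, ← Circle.norm_coe w, ← norm_mul, sub_mul,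
      div_mul_cancel₀ _ (Circle.coe_ne_zero w), one_mul]
  have h3 : 0 ≤ Real.sin (|θ| / 2) :=
    Real.sin_nonneg_of_nonneg_of_le_pi (by positivity)
      (by linarith [Complex.abs_arg_le_pi ((z / w : Circle) : ℂ), Real.pi_pos])
  rw [h2, Complex.norm_exp_I_mul_ofReal_sub_one, norm_mul, Real.norm_ofNat, Real.norm_eq_abs]
  congr 1
  rcases abs_cases θ with ⟨h, -⟩ | ⟨h, -⟩
  · rw [← abs_of_nonneg h3, h]
  · rw [← abs_of_nonneg h3, h, neg_div, Real.sin_neg, abs_neg]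

/-- Jordan's inequality gives `x ≤ 2 sin x`, hence `x ^ 2 ≤ 4 sin x ^ 2`. It remains to bound the
left side by `x ^ 2`: it is of cubic order for `x ≤ 1`, and at most `x ≤ x ^ 2` for `x ≥ 1`. -/
theorem self_sub_sin_le {x : ℝ} (h0 : 0 ≤ x) (hx : x ≤ Real.pi / 2) :
    x - Real.sin x ≤ 4 * Real.sin x ^ 2 := by
  have h1 : x ≤ 2 * Real.sin x := by
    have h := Real.mul_le_sin h0 hx
    rw [div_mul_eq_mul_div, div_le_iff₀ Real.pi_pos] at h
    nlinarith [Real.pi_lt_four, Real.sin_nonneg_of_nonneg_of_le_pi h0 (by linarith)]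
  have h2 : x ^ 2 ≤ 4 * Real.sin x ^ 2 := by nlinarith
  rcases h0.eq_or_lt with rfl | h0
  · simp
  rcases le_total x 1 with h | h
  · nlinarith [Real.sin_gt_sub_cube h0, mul_nonneg (sq_nonneg x) (sub_nonneg.2 h)]
  · nlinarith

/-- The length of an arc exceeds that of its chord by a term of second order at most. -/
theorem abs_arg_div_le (z w : Circle) :
    |Complex.arg ((z / w : Circle) : ℂ)| ≤ ‖(z : ℂ) - w‖ + 2 * ‖(z : ℂ) - w‖ ^ 2 := by
  rw [norm_coe_sub_coe]
  have h := self_sub_sin_le (x := |Complex.arg ((z / w : Circle) : ℂ)| / 2) (by positivity)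
    (by linarith [Complex.abs_arg_le_pi ((z / w : Circle) : ℂ)])
  linarith

/-! ### Spectral decompositions -/

open scoped Matrix.Norms.L2Operator in
-- The projections are the functional calculus of indicators of points. The spectrum is finite, so
-- every function is continuous on it, and one family of projections serves all `f`.
theorem exists_spectral_decomposition {N : ℕ} (U : Matrix.unitaryGroup (Fin N) ℂ) :
    ∃ (s : Finset Circle) (P : Circle → Matrix (Fin N) (Fin N) ℂ),
      (∀ z, (P z)ᴴ = P z) ∧ (∀ z, P z * P z = P z) ∧
      (∑ z ∈ s, P z = 1) ∧ (∑ z ∈ s, (z : ℂ) • P z = (U : Matrix (Fin N) (Fin N) ℂ)) ∧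
      ∀ f : Circle → ℝ, funCalc f U = ∑ z ∈ s, (f z : ℂ) • P z := by
  classical
  obtain ⟨A, hAU⟩ := U
  have hAU : A ∈ unitary (Matrix (Fin N) (Fin N) ℂ) := hAU
  have hn : IsStarNormal A := ⟨by
    rw [Commute, SemiconjBy, (Unitary.mem_iff.1 hAU).1, (Unitary.mem_iff.1 hAU).2]⟩
  have hfin : (spectrum ℂ A).Finite := A.finite_spectrum
  have hcont : ∀ g : ℂ → ℂ, ContinuousOn g (spectrum ℂ A) := hfin.continuousOn
  have hfin' : ((fun z : Circle ↦ (z : ℂ)) ⁻¹' spectrum ℂ A).Finite :=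
    hfin.preimage Circle.coe_injective.injOn
  let e : Circle → ℂ → ℂ := fun z x ↦ if x = z then 1 else 0
  have key : ∀ g : ℂ → ℂ, cfc g A = ∑ z ∈ hfin'.toFinset, g z • cfc (e z) A := by
    intro g
    simp_rw [← fun z : Circle ↦ cfc_const_mul (g z) (e z) A (hcont _)]
    rw [← cfc_sum _ _ _ fun _ _ ↦ hcont _]
    refine cfc_congr fun x hx ↦ ?_
    have hx1 : ‖x‖ = 1 := by simpa using spectrum.subset_circle_of_unitary hAU hx
    obtain ⟨z, rfl⟩ : ∃ z : Circle, (z : ℂ) = x :=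
      ⟨⟨x, mem_sphere_zero_iff_norm.2 hx1⟩, rfl⟩
    have hz : z ∈ hfin'.toFinset := by simpa using hx
    simp [e, Finset.sum_apply, Circle.coe_inj, hz]
  refine ⟨hfin'.toFinset, fun z ↦ cfc (e z) A, fun z ↦ ?_, fun z ↦ ?_, ?_, ?_, fun f ↦ ?_⟩
  · rw [← Matrix.star_eq_conjTranspose, ← cfc_star]
    congr 1
    ext x
    by_cases h : x = z <;> simp [e, h]
  · rw [← cfc_mul _ _ _ (hcont _) (hcont _)]
    congr 1
    ext x
    by_cases h : x = z <;> simp [e, h]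
  · have := key fun _ ↦ 1
    rw [cfc_const_one ℂ A] at this
    simp only [one_smul] at this
    exact this.symm
  · have := key fun x ↦ x
    rw [cfc_id' ℂ A] at this
    exact this.symm
  · rw [funCalc, key]
    exact Finset.sum_congr rfl fun z _ ↦
      congrArg (· • cfc (e z) A) (Circle.coe_injective.extend_apply _ _ z)

/-- For orthogonal projections, `Tr (P Q) = Tr ((P Q)* (P Q))` by cyclicity. -/
theorem exists_trace_mul_eq {N : ℕ} {P Q : Matrix (Fin N) (Fin N) ℂ} (hP : Pᴴ = P) (hQ : Qᴴ = Q)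
    (hPP : P * P = P) (hQQ : Q * Q = Q) : ∃ r : ℝ, 0 ≤ r ∧ (P * Q).trace = r := by
  open scoped ComplexOrder in
  have h : 0 ≤ (P * Q).trace := by
    have h1 := (Matrix.posSemidef_conjTranspose_mul_self (P * Q)).trace_nonneg
    rwa [Matrix.conjTranspose_mul, hP, hQ, Matrix.mul_assoc, ← Matrix.mul_assoc P, hPP,
      Matrix.trace_mul_comm, Matrix.mul_assoc, hQQ] at h1
  rw [Complex.nonneg_iff] at h
  exact ⟨_, h.1, Complex.ext rfl h.2.symm⟩

/-- Two unitary matrices define a coupling of their spectra, whose transport cost for the square of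
the distance in the plane is the square of their Hilbert-Schmidt distance. -/
theorem exists_coupling {N : ℕ} (U V : Matrix.unitaryGroup (Fin N) ℂ) :
    ∃ (s t : Finset Circle) (S : Circle → Circle → ℝ), (∀ z w, 0 ≤ S z w) ∧
      (∀ f : Circle → ℝ, (funCalc f U).trace.re = ∑ z ∈ s, ∑ w ∈ t, S z w * f z) ∧
      (∀ f : Circle → ℝ, (funCalc f V).trace.re = ∑ z ∈ s, ∑ w ∈ t, S z w * f w) ∧
      ∑ z ∈ s, ∑ w ∈ t, S z w = N ∧
      ∑ z ∈ s, ∑ w ∈ t, S z w * ‖(z : ℂ) - w‖ ^ 2 =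
        (((U - V : Matrix (Fin N) (Fin N) ℂ))ᴴ * (U - V : Matrix (Fin N) (Fin N) ℂ)).trace.re := by
  obtain ⟨s, P, hP, hPP, hP1, hPU, hPf⟩ := exists_spectral_decomposition U
  obtain ⟨t, Q, hQ, hQQ, hQ1, hQV, hQf⟩ := exists_spectral_decomposition V
  choose S hS0 hS using fun z w ↦ exists_trace_mul_eq (hP z) (hQ w) (hPP z) (hQQ w)
  have bil : ∀ a b : Circle → ℂ, ((∑ z ∈ s, a z • P z) * ∑ w ∈ t, b w • Q w).trace =
      ∑ z ∈ s, ∑ w ∈ t, (S z w : ℂ) * (a z * b w) := by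
    intro a b
    simp only [Finset.sum_mul, Finset.mul_sum, Matrix.trace_sum, Matrix.smul_mul, Matrix.mul_smul,
      Matrix.trace_smul, hS, smul_eq_mul]
    rw [Finset.sum_comm]
    refine Finset.sum_congr rfl fun z _ ↦ Finset.sum_congr rfl fun w _ ↦ by ring
  have hone : (∑ z ∈ s, ∑ w ∈ t, S z w) = N := by
    have := bil (fun _ ↦ 1) (fun _ ↦ 1)
    simp only [one_smul, hP1, hQ1, mul_one, Matrix.trace_one, Fintype.card_fin] at this
    exact_mod_cast this.symm
  refine ⟨s, t, S, hS0, fun f ↦ ?_, fun f ↦ ?_, hone, ?_⟩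
  · have := bil (fun z ↦ f z) (fun _ ↦ 1)
    simp only [one_smul, hQ1, mul_one, ← hPf] at this
    rw [this]; exact_mod_cast rfl
  · have := bil (fun _ ↦ 1) (fun z ↦ f z)
    simp only [one_smul, hP1, one_mul, ← hQf] at this
    rw [this]; exact_mod_cast rfl
  · have hUs : (U : Matrix (Fin N) (Fin N) ℂ)ᴴ = ∑ z ∈ s, (starRingEnd ℂ z) • P z := by
      rw [← hPU, Matrix.conjTranspose_sum]
      simp [Matrix.conjTranspose_smul, hP]
    have hc := bil (fun z ↦ starRingEnd ℂ z) (fun w ↦ w)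
    rw [← hUs, hQV] at hc
    have hUU : (U : Matrix (Fin N) (Fin N) ℂ)ᴴ * U = 1 := (Unitary.mem_iff.1 U.2).1
    have hVV : (V : Matrix (Fin N) (Fin N) ℂ)ᴴ * V = 1 := (Unitary.mem_iff.1 V.2).1
    have hVU : ((V : Matrix (Fin N) (Fin N) ℂ)ᴴ * U).trace.re =
        ((U : Matrix (Fin N) (Fin N) ℂ)ᴴ * V).trace.re := by
      rw [← Complex.conj_re, starRingEnd_apply, ← Matrix.trace_conjTranspose,
        Matrix.conjTranspose_mul, Matrix.conjTranspose_conjTranspose]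
    have hexp : (((U - V : Matrix (Fin N) (Fin N) ℂ))ᴴ * (U - V : Matrix (Fin N) (Fin N) ℂ)).trace.re =
        2 * N - 2 * ((U : Matrix (Fin N) (Fin N) ℂ)ᴴ * V).trace.re := by
      rw [Matrix.conjTranspose_sub, Matrix.sub_mul, Matrix.mul_sub, Matrix.mul_sub, hUU, hVV]
      simp only [Matrix.trace_sub, Matrix.trace_one, Fintype.card_fin, Complex.sub_re, hVU,
        Complex.natCast_re]
      ring
    rw [hexp, hc, ← hone, Complex.re_sum]
    simp_rw [Complex.re_sum, Finset.mul_sum]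
    rw [← Finset.sum_sub_distrib]
    refine Finset.sum_congr rfl fun z _ ↦ ?_
    rw [← Finset.sum_sub_distrib]
    refine Finset.sum_congr rfl fun w _ ↦ ?_
    have h1 := Circle.normSq_coe z
    have h2 := Circle.normSq_coe w
    rw [Complex.normSq_apply] at h1 h2
    rw [← Complex.normSq_eq_norm_sq, Complex.normSq_apply, Complex.re_ofReal_mul]
    simp only [Complex.sub_re, Complex.sub_im, Complex.mul_re, Complex.conj_re, Complex.conj_im]
    -- On the circle, `|z - w| ^ 2 = 2 - 2 Re (conj z * w)`.
    linear_combination S z w * h1 + S z w * h2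

/-! ### The Hilbert-Schmidt norm -/

/-- The entries of a matrix, as a vector of a Euclidean space, whose norm is the Hilbert-Schmidt
norm of the matrix. -/
def entries {N : ℕ} (A : Matrix (Fin N) (Fin N) ℂ) : EuclideanSpace ℂ (Fin N × Fin N) :=
  WithLp.toLp 2 fun p ↦ A p.1 p.2

theorem norm_entries_sq {N : ℕ} (A : Matrix (Fin N) (Fin N) ℂ) :
    ‖entries A‖ ^ 2 = (Aᴴ * A).trace.re := by
  rw [EuclideanSpace.norm_sq_eq, Fintype.sum_prod_type, Finset.sum_comm, Matrix.trace,
    Complex.re_sum]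
  refine Finset.sum_congr rfl fun j _ ↦ ?_
  rw [Matrix.diag_apply, Matrix.mul_apply, Complex.re_sum]
  refine Finset.sum_congr rfl fun i _ ↦ ?_
  rw [Matrix.conjTranspose_apply, ← Complex.normSq_eq_norm_sq, Complex.normSq_apply]
  simp [entries]

theorem entries_sub {N : ℕ} (A B : Matrix (Fin N) (Fin N) ℂ) :
    entries (A - B) = entries A - entries B := rfl

theorem lieNorm_eq {N : ℕ} (A : Matrix (Fin N) (Fin N) ℂ) :
    lieNorm A = √N * ‖entries A‖ := by
  rw [lieNorm, lieInner, ← norm_entries_sq, Real.sqrt_mul (Nat.cast_nonneg N),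
    Real.sqrt_sq (norm_nonneg _)]

/-- Because of this invariance, the Riemannian length is `√N` times the Euclidean length in the
space of matrices. -/
theorem norm_entries_conjTranspose_mul {N : ℕ} {U : Matrix (Fin N) (Fin N) ℂ}
    (hU : U ∈ Matrix.unitaryGroup (Fin N) ℂ) (A : Matrix (Fin N) (Fin N) ℂ) :
    ‖entries (Uᴴ * A)‖ = ‖entries A‖ := by
  have hUU : U * Uᴴ = 1 := (Unitary.mem_iff.1 hU).2
  refine (sq_eq_sq₀ (norm_nonneg _) (norm_nonneg _)).1 ?_
  rw [norm_entries_sq, norm_entries_sq, Matrix.conjTranspose_mul, Matrix.conjTranspose_conjTranspose,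
    Matrix.mul_assoc, ← Matrix.mul_assoc U, hUU, Matrix.one_mul]

/-- The Lipschitz estimate for the trace of `f(U)`, up to a term of second order. -/
theorem abs_trace_funCalc_sub_le {N : ℕ} {f : Circle → ℝ} {L : ℝ} (hL : 0 ≤ L)
    (hf : ∀ z w : Circle, |f z - f w| ≤ L * |Complex.arg ((z / w : Circle) : ℂ)|)
    (U V : Matrix.unitaryGroup (Fin N) ℂ) :
    |(funCalc f U).trace.re - (funCalc f V).trace.re| ≤
      L * √N * ‖entries (U : Matrix (Fin N) (Fin N) ℂ) - entries V‖ +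
        2 * L * ‖entries (U : Matrix (Fin N) (Fin N) ℂ) - entries V‖ ^ 2 := by
  obtain ⟨s, t, S, hS0, hU, hV, hS1, hS2⟩ := exists_coupling U V
  rw [← norm_entries_sq, entries_sub] at hS2
  set D := ‖entries (U : Matrix (Fin N) (Fin N) ℂ) - entries V‖
  -- Cauchy-Schwarz for the weights `S`; the factor `√N` comes from their total mass `N`.
  have hCS : ∑ z ∈ s, ∑ w ∈ t, S z w * ‖(z : ℂ) - w‖ ≤ √N * D := by
    rw [← Finset.sum_product'] at hS1 hS2 ⊢
    have h := Finset.sum_mul_sq_le_sq_mul_sq (s ×ˢ t) (fun p ↦ √(S p.1 p.2))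
      (fun p ↦ √(S p.1 p.2) * ‖(p.1 : ℂ) - p.2‖)
    simp only [← mul_assoc, mul_pow, Real.mul_self_sqrt (hS0 _ _), Real.sq_sqrt (hS0 _ _), hS1,
      hS2] at h
    refine abs_le_of_sq_le_sq' ?_ (by positivity) |>.2
    rwa [mul_pow, Real.sq_sqrt (Nat.cast_nonneg N)]
  calc |(funCalc f U).trace.re - (funCalc f V).trace.re|
      = |∑ z ∈ s, ∑ w ∈ t, S z w * (f z - f w)| := by
        simp_rw [hU, hV, mul_sub, Finset.sum_sub_distrib]
    _ ≤ ∑ z ∈ s, ∑ w ∈ t, |S z w * (f z - f w)| :=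
        (Finset.abs_sum_le_sum_abs _ _).trans
          (Finset.sum_le_sum fun _ _ ↦ Finset.abs_sum_le_sum_abs _ _)
    _ ≤ ∑ z ∈ s, ∑ w ∈ t, (L * (S z w * ‖(z : ℂ) - w‖) +
          2 * L * (S z w * ‖(z : ℂ) - w‖ ^ 2)) := by
        refine Finset.sum_le_sum fun z _ ↦ Finset.sum_le_sum fun w _ ↦ ?_
        rw [abs_mul, abs_of_nonneg (hS0 z w)]
        calc S z w * |f z - f w|
            ≤ S z w * (L * (‖(z : ℂ) - w‖ + 2 * ‖(z : ℂ) - w‖ ^ 2)) := by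
              gcongr
              · exact hS0 z w
              · exact (hf z w).trans (by gcongr; exact abs_arg_div_le z w)
          _ = _ := by ring
    _ = L * (∑ z ∈ s, ∑ w ∈ t, S z w * ‖(z : ℂ) - w‖) + 2 * L * D ^ 2 := by
        simp_rw [Finset.sum_add_distrib, ← Finset.mul_sum, hS2]
    _ ≤ L * √N * D + 2 * L * D ^ 2 := by
        rw [mul_assoc L]
        gcongr

/-! ### Integration along a path -/

/-- An infinitesimal Lipschitz estimate along a path of class `C^1` integrates to an estimate by the
length of the path. -/
theorem abs_sub_le_integral_norm {E : Type*} [NormedAddCommGroup E] [NormedSpace ℝ E]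
    [CompleteSpace E] {c c' : ℝ → E} {φ : ℝ → ℝ} {A B : ℝ} (hA : 0 ≤ A) (hB : 0 ≤ B)
    (hc : ContinuousOn c (Set.Icc 0 1)) (hc' : ContinuousOn c' (Set.Icc 0 1))
    (hd : ∀ t ∈ Set.Ioo (0 : ℝ) 1, HasDerivAt c (c' t) t)
    (hφ : ∀ s ∈ Set.Icc (0 : ℝ) 1, ∀ t ∈ Set.Icc (0 : ℝ) 1,
      |φ s - φ t| ≤ A * ‖c s - c t‖ + B * ‖c s - c t‖ ^ 2) :
    |φ 0 - φ 1| ≤ A * ∫ t in (0 : ℝ)..1, ‖c' t‖ := by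
  obtain ⟨K, hK⟩ := isCompact_Icc.exists_bound_of_continuousOn hc'
  have hK0 : 0 ≤ K := (norm_nonneg _).trans (hK 0 (by simp))
  have sub : ∀ {s t : ℝ}, 0 ≤ s → t ≤ 1 → Set.Icc s t ⊆ Set.Icc (0 : ℝ) 1 :=
    fun h h' ↦ Set.Icc_subset_Icc h h'
  have hint : ∀ s t : ℝ, 0 ≤ s → s ≤ t → t ≤ 1 →
      IntervalIntegrable (fun x ↦ ‖c' x‖) MeasureTheory.volume s t := fun s t h0 hst h1 ↦
    (hc'.norm.mono ((Set.uIcc_of_le hst).subset.trans (sub h0 h1))).intervalIntegrable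
  have inc : ∀ s t : ℝ, 0 ≤ s → s ≤ t → t ≤ 1 →
      ‖c s - c t‖ ≤ ∫ x in s..t, ‖c' x‖ := fun s t h0 hst h1 ↦ by
    rw [norm_sub_rev, ← intervalIntegral.integral_eq_sub_of_hasDerivAt_of_le hst
      (hc.mono (sub h0 h1)) (fun x hx ↦ hd x ⟨h0.trans_lt hx.1, hx.2.trans_le h1⟩)
      (hc'.mono ((Set.uIcc_of_le hst).subset.trans (sub h0 h1))).intervalIntegrable]
    exact intervalIntegral.norm_integral_le_integral_norm hst
  have lip : ∀ s t : ℝ, 0 ≤ s → s ≤ t → t ≤ 1 → ‖c s - c t‖ ≤ K * (t - s) := fun s t h0 hst h1 ↦ by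
    refine (inc s t h0 hst h1).trans ?_
    calc ∫ x in s..t, ‖c' x‖ ≤ ∫ _ in s..t, K :=
          intervalIntegral.integral_mono_on hst (hint s t h0 hst h1) (by simp)
            fun x hx ↦ hK x (sub h0 h1 hx)
      _ = K * (t - s) := by simp [mul_comm]
  set I := ∫ t in (0 : ℝ)..1, ‖c' t‖
  -- Cut `[0, 1]` into `n + 1` equal pieces: the linear terms add up to at most `A * I`, and each
  -- quadratic term is at most `B * (K / (n + 1)) ^ 2`.
  have bound : ∀ n : ℕ, |φ 0 - φ 1| ≤ A * I + B * K ^ 2 * (1 / ((n : ℝ) + 1)) := by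
    intro n
    let a : ℕ → ℝ := fun k ↦ k / ((n : ℝ) + 1)
    have hn : (0 : ℝ) < n + 1 := by positivity
    have ha0 : ∀ k, 0 ≤ a k := fun k ↦ by positivity
    have ha1 : ∀ k < n + 1, a (k + 1) ≤ 1 := fun k hk ↦ by
      rw [div_le_one hn]; exact_mod_cast hk
    have hstep : ∀ k, a (k + 1) - a k = 1 / ((n : ℝ) + 1) := fun k ↦ by
      simp only [a]; push_cast; ring
    have hmono : ∀ k, a k ≤ a (k + 1) := fun k ↦ by
      have : (0 : ℝ) ≤ 1 / ((n : ℝ) + 1) := by positivity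
      linarith [hstep k]
    have hfirst : a 0 = 0 := by simp [a]
    have hlast : a (n + 1) = 1 := by simp only [a]; push_cast; exact div_self hn.ne'
    calc |φ 0 - φ 1| = |∑ k ∈ Finset.range (n + 1), (φ (a k) - φ (a (k + 1)))| := by
          rw [Finset.sum_range_sub' fun k ↦ φ (a k), hfirst, hlast]
      _ ≤ ∑ k ∈ Finset.range (n + 1), |φ (a k) - φ (a (k + 1))| :=
          Finset.abs_sum_le_sum_abs _ _
      _ ≤ ∑ k ∈ Finset.range (n + 1),
            (A * (∫ x in a k..a (k + 1), ‖c' x‖) + B * (K * (1 / ((n : ℝ) + 1))) ^ 2) := by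
          refine Finset.sum_le_sum fun k hk ↦ ?_
          have hk := ha1 k (Finset.mem_range.1 hk)
          refine (hφ _ ⟨ha0 k, (hmono k).trans hk⟩ _ ⟨ha0 _, hk⟩).trans ?_
          gcongr
          · exact inc _ _ (ha0 k) (hmono k) hk
          · rw [← hstep k]
            exact lip _ _ (ha0 k) (hmono k) hk
      _ = A * I + B * K ^ 2 * (1 / ((n : ℝ) + 1)) := by
          rw [Finset.sum_add_distrib, ← Finset.mul_sum,
            intervalIntegral.sum_integral_adjacent_intervals fun k hk ↦
              hint _ _ (ha0 k) (hmono k) (ha1 k hk), hfirst, hlast]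
          simp only [Finset.sum_const, Finset.card_range, nsmul_eq_mul]
          push_cast
          field_simp
          ring
  have hlim : Filter.Tendsto (fun n : ℕ ↦ A * I + B * K ^ 2 * (1 / ((n : ℝ) + 1))) Filter.atTop
      (nhds (A * I + B * K ^ 2 * 0)) :=
    (tendsto_one_div_add_atTop_nhds_zero_nat.const_mul _).const_add _
  rw [mul_zero, add_zero] at hlim
  exact ge_of_tendsto' hlim bound

/-! ### Paths in the unitary group -/

theorem IsC1Path.continuousOn_velocity {N : ℕ} {U V : Matrix.unitaryGroup (Fin N) ℂ}
    {γ : ℝ → Matrix (Fin N) (Fin N) ℂ} (hγ : IsC1Path U V γ) :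
    ContinuousOn (fun t ↦ entries (velocity γ t)) (Set.Icc 0 1) := by
  refine (PiLp.continuous_toLp 2 _).comp_continuousOn (continuousOn_pi.2 fun p ↦ ?_)
  exact (hγ.contDiffOn p.1 p.2).continuousOn_derivWithin (uniqueDiffOn_Icc zero_lt_one) le_rfl

theorem IsC1Path.hasDerivAt {N : ℕ} {U V : Matrix.unitaryGroup (Fin N) ℂ}
    {γ : ℝ → Matrix (Fin N) (Fin N) ℂ} (hγ : IsC1Path U V γ) {t : ℝ} (ht : t ∈ Set.Ioo (0 : ℝ) 1) :
    HasDerivAt (fun s ↦ entries (γ s)) (entries (velocity γ t)) t := by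
  have h : HasDerivAt (fun s (p : Fin N × Fin N) ↦ γ s p.1 p.2)
      (fun p ↦ velocity γ t p.1 p.2) t :=
    hasDerivAt_pi.2 fun p ↦ (((hγ.contDiffOn p.1 p.2).differentiableOn one_ne_zero t
      (Set.Ioo_subset_Icc_self ht)).hasDerivWithinAt).hasDerivAt (Icc_mem_nhds ht.1 ht.2)
  exact ((PiLp.continuousLinearEquiv 2 ℝ fun _ : Fin N × Fin N ↦ ℂ).symm.hasFDerivAt).comp_hasDerivAt
    t h

theorem IsC1Path.pathLength_eq {N : ℕ} {U V : Matrix.unitaryGroup (Fin N) ℂ}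
    {γ : ℝ → Matrix (Fin N) (Fin N) ℂ} (hγ : IsC1Path U V γ) :
    pathLength γ = ENNReal.ofReal (√N * ∫ t in (0 : ℝ)..1, ‖entries (velocity γ t)‖) := by
  rw [← intervalIntegral.integral_const_mul, intervalIntegral.integral_of_le zero_le_one,
    ← MeasureTheory.integral_Icc_eq_integral_Ioc,
    MeasureTheory.ofReal_integral_eq_lintegral_ofReal, pathLength]
  · refine MeasureTheory.setLIntegral_congr_fun measurableSet_Icc fun t ht ↦ ?_
    simp only [lieNorm_eq, norm_entries_conjTranspose_mul (hγ.mem t ht)]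
  · exact (continuousOn_const.mul hγ.continuousOn_velocity.norm).integrableOn_Icc
  · exact Filter.Eventually.of_forall fun t ↦ by positivity

theorem ofReal_abs_trFun_sub_le {N : ℕ} (hN : 1 ≤ N) {f : Circle → ℝ} {L : ℝ≥0}
    (hf : ∀ z w : Circle, |f z - f w| ≤ L * |Complex.arg ((z / w : Circle) : ℂ)|)
    {U V : Matrix.unitaryGroup (Fin N) ℂ} {γ : ℝ → Matrix (Fin N) (Fin N) ℂ}
    (hγ : IsC1Path U V γ) :
    ENNReal.ofReal |trFun f U - trFun f V| ≤ ((L / N : ℝ≥0) : ℝ≥0∞) * pathLength γ := by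
  have hN' : (0 : ℝ) < N := by exact_mod_cast hN
  classical
  -- Since `γ` need not be unitary outside `[0, 1]`, a default value is used there.
  let u : ℝ → Matrix.unitaryGroup (Fin N) ℂ := fun t ↦
    if h : γ t ∈ Matrix.unitaryGroup (Fin N) ℂ then ⟨γ t, h⟩ else 1
  have hu : ∀ t ∈ Set.Icc (0 : ℝ) 1, (u t : Matrix (Fin N) (Fin N) ℂ) = γ t := fun t ht ↦ by
    simp only [u, dif_pos (hγ.mem t ht)]
  have h0 : u 0 = U := Subtype.ext ((hu 0 (by simp)).trans hγ.source)
  have h1 : u 1 = V := Subtype.ext ((hu 1 (by simp)).trans hγ.target)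
  have key := abs_sub_le_integral_norm (c := fun t ↦ entries (γ t))
    (c' := fun t ↦ entries (velocity γ t)) (φ := fun t ↦ (funCalc f (u t)).trace.re)
    (A := L * √N) (B := 2 * L) (by positivity) (by positivity)
    ((PiLp.continuous_toLp 2 _).comp_continuousOn
      (continuousOn_pi.2 fun p ↦ (hγ.contDiffOn p.1 p.2).continuousOn))
    hγ.continuousOn_velocity (fun t ht ↦ hγ.hasDerivAt ht) fun s hs t ht ↦ by
      have := abs_trace_funCalc_sub_le (NNReal.coe_nonneg L) hf (u s) (u t)
      simpa only [hu s hs, hu t ht] using this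
  rw [h0, h1] at key
  rw [hγ.pathLength_eq, ← ENNReal.ofReal_coe_nnreal, ← ENNReal.ofReal_mul (by positivity)]
  refine ENNReal.ofReal_le_ofReal ?_
  rw [trFun, trFun, ← sub_div, abs_div, abs_of_pos hN', div_le_iff₀ hN']
  refine key.trans_eq ?_
  push_cast
  field_simp

/-! ### Scalar matrices -/

/-- The scalar unitary matrix `z I`. -/
def scalarUnitary (N : ℕ) (z : Circle) : Matrix.unitaryGroup (Fin N) ℂ :=
  ⟨(z : ℂ) • (1 : Matrix (Fin N) (Fin N) ℂ), by
    have h : star (z : ℂ) * z = 1 := by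
      rw [← starRingEnd_apply, mul_comm, Complex.mul_conj, Circle.normSq_coe, Complex.ofReal_one]
    have h' : (z : ℂ) * star (z : ℂ) = 1 := by rw [mul_comm, h]
    rw [Matrix.mem_unitaryGroup_iff, star_smul, star_one, smul_mul_smul_comm, h', mul_one,
      one_smul]⟩

theorem coe_scalarUnitary (N : ℕ) (z : Circle) :
    (scalarUnitary N z : Matrix (Fin N) (Fin N) ℂ) = (z : ℂ) • 1 := rfl

theorem scalarUnitary_injective {N : ℕ} (hN : 1 ≤ N) : Function.Injective (scalarUnitary N) := by
  intro z w h
  have := congrFun₂ (congrArg Subtype.val h) ⟨0, hN⟩ ⟨0, hN⟩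
  simpa [coe_scalarUnitary, Circle.coe_inj] using this

open scoped Matrix.Norms.L2Operator in
theorem trFun_scalarUnitary {N : ℕ} (hN : 1 ≤ N) (f : Circle → ℝ) (z : Circle) :
    trFun f (scalarUnitary N z) = f z := by
  have hN' : (N : ℝ) ≠ 0 := by exact_mod_cast Nat.one_le_iff_ne_zero.1 hN
  rw [trFun, funCalc, coe_scalarUnitary, ← Algebra.algebraMap_eq_smul_one, cfc_algebraMap,
    show Function.extend ((↑) : Circle → ℂ) (fun z ↦ (f z : ℂ)) 0 (z : ℂ) = f z from
      Circle.coe_injective.extend_apply _ _ z, Algebra.algebraMap_eq_smul_one, Matrix.trace_smul,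
    Matrix.trace_one, Fintype.card_fin, smul_eq_mul, Complex.re_ofReal_mul, Complex.natCast_re,
    mul_div_cancel_right₀ _ hN']

/-- The path `z e^{-itθ} I` follows a shortest arc. Its speed is `N |θ|`: one `√N` comes from the
scalar product, the other from the Hilbert-Schmidt norm of `I`. -/
theorem riemDist_scalarUnitary_le {N : ℕ} (z w : Circle) :
    riemDist (scalarUnitary N z) (scalarUnitary N w) ≤ N * arcDist z w := by
  set θ := Complex.arg ((z / w : Circle) : ℂ) with hθ
  have hzw : Circle.exp θ = z / w := Circle.exp_arg _
  let g : ℝ → Circle := fun t ↦ z * Circle.exp (-(t * θ))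
  have hgs : ∀ s : ℝ, (g s : ℂ) = z * Complex.exp (-((s : ℂ) * θ) * Complex.I) := fun s ↦ by
    simp only [g, Circle.coe_mul, Circle.coe_exp, Complex.ofReal_neg, Complex.ofReal_mul]
  have hg : ∀ t, HasDerivAt (fun s ↦ (g s : ℂ)) (g t * (-(θ * Complex.I))) t := fun t ↦ by
    have h : HasDerivAt (fun s : ℝ ↦ -((s : ℂ) * θ) * Complex.I) (-(1 * θ) * Complex.I) t :=
      (((Complex.ofRealCLM.hasDerivAt (x := t)).mul_const (θ : ℂ)).neg).mul_const Complex.I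
    rw [funext hgs, hgs]
    exact (h.cexp.const_mul (z : ℂ)).congr_deriv (by ring)
  have hgc : ContDiff ℝ 1 fun s ↦ (g s : ℂ) := by
    rw [funext hgs]
    exact contDiff_const.mul
      ((((Complex.ofRealCLM.contDiff.mul contDiff_const).neg).mul contDiff_const).cexp)
  let γ : ℝ → Matrix (Fin N) (Fin N) ℂ := fun t ↦ scalarUnitary N (g t)
  have hγ : IsC1Path (scalarUnitary N z) (scalarUnitary N w) γ :=
    { mem := fun t _ ↦ (scalarUnitary N (g t)).2
      source := by simp [γ, g]
      target := by
        simp only [γ, g, one_mul, Circle.exp_neg, hzw]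
        congr 2
        simp
      contDiffOn := fun i j ↦ by
        simp only [γ, coe_scalarUnitary, Matrix.smul_apply, smul_eq_mul]
        exact (hgc.mul contDiff_const).contDiffOn }
  have hv : ∀ t ∈ Set.Icc (0 : ℝ) 1, velocity γ t = ((g t : ℂ) * (-(θ * Complex.I))) • 1 := by
    intro t ht
    ext i j
    simp only [velocity, Matrix.of_apply, γ, coe_scalarUnitary, Matrix.smul_apply, smul_eq_mul]
    exact ((hg t).mul_const _).hasDerivWithinAt.derivWithin (uniqueDiffOn_Icc zero_lt_one t ht)
  have hn : ∀ t ∈ Set.Icc (0 : ℝ) 1, ‖entries (velocity γ t)‖ = √N * |θ| := by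
    intro t ht
    refine (sq_eq_sq₀ (norm_nonneg _) (by positivity)).1 ?_
    rw [norm_entries_sq, hv t ht, Matrix.conjTranspose_smul, Matrix.conjTranspose_one,
      smul_mul_smul_comm, mul_one, Matrix.trace_smul, Matrix.trace_one, Fintype.card_fin,
      ← starRingEnd_apply, mul_comm (starRingEnd ℂ _), Complex.mul_conj, Complex.normSq_eq_norm_sq,
      norm_mul, Circle.norm_coe, mul_pow (√N), Real.sq_sqrt (Nat.cast_nonneg N), smul_eq_mul,
      Complex.re_ofReal_mul, Complex.natCast_re]
    simp [mul_comm]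
  refine (iInf₂_le γ hγ).trans_eq ?_
  rw [hγ.pathLength_eq, intervalIntegral.integral_congr (g := fun _ ↦ √N * |θ|)
    (fun t ht ↦ hn t (by rwa [Set.uIcc_of_le zero_le_one] at ht)),
    intervalIntegral.integral_const, sub_zero, one_smul, ← mul_assoc,
    Real.mul_self_sqrt (Nat.cast_nonneg N), ENNReal.ofReal_mul (Nat.cast_nonneg N),
    ENNReal.ofReal_natCast, arcDist]

/-! ### Lipschitz norms -/

theorem arcDist_ne_zero {z w : Circle} (h : z ≠ w) : arcDist z w ≠ 0 := by
  rw [arcDist, Ne, ENNReal.ofReal_eq_zero, not_le, abs_pos]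
  intro h0
  refine h (div_eq_one.1 ?_)
  rw [← Circle.exp_arg (z / w), h0, Circle.exp_zero]

theorem lipNorm_le {X : Type*} {d : X → X → ℝ≥0∞} {F : X → ℝ} {K : ℝ≥0}
    (h : ∀ x y, ENNReal.ofReal |F x - F y| ≤ K * d x y) : lipNorm d F ≤ K :=
  iSup_le fun x ↦ iSup₂_le fun y _ ↦ ENNReal.div_le_of_le_mul (h x y)

theorem abs_sub_le_lipNorm_arcDist {f : Circle → ℝ} (h : lipNorm arcDist f ≠ ⊤) (z w : Circle) :
    |f z - f w| ≤ (lipNorm arcDist f).toNNReal * |Complex.arg ((z / w : Circle) : ℂ)| := by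
  rcases eq_or_ne z w with rfl | hzw
  · simp
  have h1 : ENNReal.ofReal |f z - f w| / arcDist z w ≤ lipNorm arcDist f :=
    le_iSup_of_le z (le_iSup₂_of_le w hzw le_rfl)
  rw [ENNReal.div_le_iff (arcDist_ne_zero hzw) ENNReal.ofReal_ne_top, arcDist,
    ← ENNReal.coe_toNNReal h, ← ENNReal.ofReal_coe_nnreal,
    ← ENNReal.ofReal_mul (NNReal.coe_nonneg _)] at h1
  exact (ENNReal.ofReal_le_ofReal_iff (by positivity)).1 h1

/-- Distances sit in the denominator, so an upper bound on the distance between scalar matrices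
suffices. -/
theorem lipNorm_arcDist_div_le {N : ℕ} (hN : 1 ≤ N) (f : Circle → ℝ) :
    lipNorm arcDist f / N ≤ lipNorm (riemDist (N := N)) (trFun f) := by
  refine ENNReal.div_le_of_le_mul (iSup_le fun z ↦ iSup₂_le fun w hzw ↦ ?_)
  have hN0 : (N : ℝ≥0∞) ≠ 0 := by exact_mod_cast Nat.one_le_iff_ne_zero.1 hN
  have h1 : ENNReal.ofReal |f z - f w| / (N * arcDist z w) ≤
      lipNorm (riemDist (N := N)) (trFun f) := by
    refine le_trans ?_ (le_iSup_of_le (scalarUnitary N z)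
      (le_iSup₂_of_le (scalarUnitary N w) ((scalarUnitary_injective hN).ne hzw) le_rfl))
    rw [trFun_scalarUnitary hN, trFun_scalarUnitary hN]
    exact ENNReal.div_le_div_left (riemDist_scalarUnitary_le z w) _
  rw [ENNReal.div_le_iff (mul_ne_zero hN0 (arcDist_ne_zero hzw))
    (ENNReal.mul_ne_top (ENNReal.natCast_ne_top N) ENNReal.ofReal_ne_top), ← mul_assoc] at h1
  exact ENNReal.div_le_of_le_mul h1

/-- The strict inequality makes `K` nonzero, so one can divide by it and pass to the infimum over
paths. With `K = 0` the convention `0 * ∞ = 0` would require knowing that a path exists. -/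
theorem abs_trFun_sub_le_mul_riemDist {N : ℕ} (hN : 1 ≤ N) {f : Circle → ℝ} {L K : ℝ≥0}
    (hf : ∀ z w : Circle, |f z - f w| ≤ L * |Complex.arg ((z / w : Circle) : ℂ)|)
    (hK : L / N < K) (U V : Matrix.unitaryGroup (Fin N) ℂ) :
    ENNReal.ofReal |trFun f U - trFun f V| ≤ K * riemDist U V := by
  have hK0 : (K : ℝ≥0∞) ≠ 0 := ENNReal.coe_ne_zero.2 (zero_le.trans_lt hK).ne'
  rw [← ENNReal.div_le_iff' hK0 ENNReal.coe_ne_top]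
  refine le_iInf₂ fun γ hγ ↦ ?_
  rw [ENNReal.div_le_iff' hK0 ENNReal.coe_ne_top]
  refine (ofReal_abs_trFun_sub_le hN hf hγ).trans ?_
  gcongr

end UnitaryLip

theorem mainTheorem8 (N : ℕ) (hN : 1 ≤ N) (f : Circle → ℝ)
    (hf : UnitaryLip.IsLipschitz UnitaryLip.arcDist f) :
    UnitaryLip.IsLipschitz (UnitaryLip.riemDist (N := N)) (UnitaryLip.trFun f) ∧
      UnitaryLip.lipNorm (UnitaryLip.riemDist (N := N)) (UnitaryLip.trFun f) =
        UnitaryLip.lipNorm UnitaryLip.arcDist f / N := by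
  obtain ⟨K, hK⟩ := hf
  have htop : UnitaryLip.lipNorm UnitaryLip.arcDist f ≠ ⊤ :=
    ((UnitaryLip.lipNorm_le hK).trans_lt ENNReal.coe_lt_top).ne
  have hL := UnitaryLip.abs_sub_le_lipNorm_arcDist htop
  refine ⟨⟨_, UnitaryLip.abs_trFun_sub_le_mul_riemDist hN hL (lt_add_one _)⟩,
    le_antisymm ?_ (UnitaryLip.lipNorm_arcDist_div_le hN f)⟩
  -- The slack `ε` provides the strict inequality `L / N < K` with `K = L / N + ε`.
  refine ENNReal.le_of_forall_pos_le_add fun ε hε _ ↦ ?_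
  have h := UnitaryLip.lipNorm_le
    (UnitaryLip.abs_trFun_sub_le_mul_riemDist hN hL (lt_add_of_pos_right _ hε))
  rwa [ENNReal.coe_add, ENNReal.coe_div (by exact_mod_cast Nat.one_le_iff_ne_zero.1 hN),
    ENNReal.coe_toNNReal htop, ENNReal.coe_natCast] at h
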